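/- Let $\mathfrak g$ be a finite-dimensional nilpotent (right) Leibniz algebra over a field $\mathbb F$, that is, a vector space with a bilinear bracket satisfying $[x,[y,z]]=[[x,y],z]-[[x,z],y]$ whose lower central series $\mathfrak g\supseteq[\mathfrak g,\mathfrak g]\supseteq[[\mathfrak g,\mathfrak g],\mathfrak g]\supseteq\cdots$ reaches $0$. Let $\mathfrak g^2=[\mathfrak g,\mathfrak g]$ be the linear span of all brackets, let $Z(\mathfrak g)=\{x : [x,y]=[y,x]=0 \text{ for all } y\in\mathfrak g\}$ be the center, and for a Leibniz algebra $\mathfrak h$ let $d(\mathfrak h)$ be the least number of elements generating $\mathfrak h$ as a Leibniz algebra. Let $HL_2(\mathfrak g)=\ker\partial_2/\operatorname{im}\partial_3$ be the second Leibniz homology of $\mathfrak g$ with trivial coefficients, where $$\partial_n:\mathfrak g^{\otimes n}\to\mathfrak g^{\otimes(n-1)},\qquad \partial_n(x_1\otimes\cdots\otimes x_n)=\sum_{1\le i<j\le n}(-1)^{j}\,x_1\otimes\cdots\otimes[x_i,x_j]\otimes\cdots\otimes\widehat{x_j}\otimes\cdots\otimes x_n ,$$ with $[x_i,x_j]$ in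 the $i$-th place and $x_j$ omitted. Then $$\dim HL_2(\mathfrak g)\le(\dim\mathfrak g-\dim\mathfrak g^2)^2+2\,\dim(\mathfrak g^2)\;d\big(\mathfrak g/Z(\mathfrak g)\big),$$ and equality holds if and only if $\mathfrak g$ is abelian (that is, $[x,y]=0$ for all $x,y\in\mathfrak g$). -/

import Mathlib

open scoped TensorProduct

/-- A (right) Leibniz algebra structure on an `F`-vector space `g`: a bilinear bracket with
`[x, [y, z]] = [[x, y], z] - [[x, z], y]`. -/
class LeibnizAlgebra (F : Type*) (g : Type*) [Field F] [AddCommGroup g] [Module F g] where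
  /-- the bracket, as a bilinear map -/
  bracket : g →ₗ[F] g →ₗ[F] g
  leibniz : ∀ x y z : g,
    bracket x (bracket y z) = bracket (bracket x y) z - bracket (bracket x z) y

/-- A two-sided ideal of a Leibniz algebra. -/
structure LeibnizIdeal (F : Type*) (g : Type*) [Field F] [AddCommGroup g] [Module F g]
    [LeibnizAlgebra F g] extends Submodule F g where
  bracket_mem_left : ∀ x ∈ toSubmodule, ∀ y : g,
    LeibnizAlgebra.bracket (F := F) x y ∈ toSubmodule
  bracket_mem_right : ∀ x ∈ toSubmodule, ∀ y : g,
    LeibnizAlgebra.bracket (F := F) y x ∈ toSubmodule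

namespace LeibnizAlgebra

section Basic

variable (F : Type*) (g : Type*) [Field F] [AddCommGroup g] [Module F g] [LeibnizAlgebra F g]

/-- All brackets vanish. -/
def IsAbelian : Prop := ∀ x y : g, bracket (F := F) x y = 0

/-- `[U, V]`: the linear span of all `[u, v]` with `u ∈ U`, `v ∈ V`. -/
def commutator (U V : Submodule F g) : Submodule F g :=
  Submodule.map₂ (bracket (F := F) (g := g)) U V

/-- The derived subalgebra `g² = [g, g]`. -/
def derived : Submodule F g := commutator F g ⊤ ⊤

/-- The lower central series: `g, [g, g], [[g, g], g], …` (starting at index `0`). -/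
def lowerCentralSeries : ℕ → Submodule F g
  | 0 => ⊤
  | k + 1 => commutator F g (lowerCentralSeries k) ⊤

/-- The lower central series reaches zero. -/
def IsNilpotent : Prop := ∃ k : ℕ, lowerCentralSeries F g k = ⊥

/-- The (two-sided) center `Z(g) = {x | [x, y] = [y, x] = 0 for all y}`, as an ideal. -/
def center : LeibnizIdeal F g where
  carrier := {x | ∀ y : g, bracket (F := F) x y = 0 ∧ bracket (F := F) y x = 0}
  zero_mem' := by simp
  add_mem' := by
    intro a b ha hb y
    simp [(ha y).1, (ha y).2, (hb y).1, (hb y).2]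
  smul_mem' := by
    intro c x hx y
    simp [(hx y).1, (hx y).2]
  bracket_mem_left := by
    intro x hx y z
    simp [(hx y).1]
  bracket_mem_right := by
    intro x hx y z
    simp [(hx y).2]

/-- The Leibniz subalgebra generated by `s` (the least subspace that contains `s` and is closed
under the bracket). -/
def generatedBy (s : Set g) : Submodule F g :=
  sInf {U | s ⊆ U ∧ ∀ x ∈ U, ∀ y ∈ U, bracket (F := F) x y ∈ U}

/-- `d(g)`: the least number of elements that generate `g` as a Leibniz algebra. -/
noncomputable def minGenerators : ℕ :=
  sInf {n : ℕ | ∃ s : Finset g, s.card = n ∧ generatedBy F g (s : Set g) = ⊤}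

end Basic

section Quotient

variable {F : Type*} {g : Type*} [Field F] [AddCommGroup g] [Module F g] [LeibnizAlgebra F g]

/-- The bracket of `g ⧸ I` induced by that of `g`. -/
def quotientBracket (I : LeibnizIdeal F g) :
    (g ⧸ I.toSubmodule) →ₗ[F] (g ⧸ I.toSubmodule) →ₗ[F] (g ⧸ I.toSubmodule) :=
  I.toSubmodule.liftQ
    (I.toSubmodule.liftQ ((bracket (F := F) (g := g)).compr₂ I.toSubmodule.mkQ).flip (by
      intro x hx
      ext y
      exact (Submodule.Quotient.mk_eq_zero _).2 (I.bracket_mem_right x hx y))).flip (by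
    intro x hx
    ext y
    exact (Submodule.Quotient.mk_eq_zero _).2 (I.bracket_mem_left x hx y))

@[simp]
theorem quotientBracket_mk (I : LeibnizIdeal F g) (x y : g) :
    quotientBracket I (Submodule.Quotient.mk x) (Submodule.Quotient.mk y) =
      Submodule.Quotient.mk (bracket (F := F) x y) := rfl

/-- The quotient Leibniz algebra `g ⧸ I`. -/
instance quotient (I : LeibnizIdeal F g) : LeibnizAlgebra F (g ⧸ I.toSubmodule) where
  bracket := quotientBracket I
  leibniz := by
    intro x y z
    obtain ⟨x, rfl⟩ := Submodule.Quotient.mk_surjective _ x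
    obtain ⟨y, rfl⟩ := Submodule.Quotient.mk_surjective _ y
    obtain ⟨z, rfl⟩ := Submodule.Quotient.mk_surjective _ z
    simp [leibniz x y z]

end Quotient

section Homology

variable (F : Type*) (g : Type*) [Field F] [AddCommGroup g] [Module F g] [LeibnizAlgebra F g]

/-- The chain space `CLₙ(g) = g ⊗ ⋯ ⊗ g` (`n` factors). -/
abbrev CL (n : ℕ) : Type _ := ⨂[F] _ : Fin n, g

/-- For `i.castSucc < j` (so that `j.succAbove i = i.castSucc`) this is the multilinear map
`(x₀, …, xₙ) ↦ x₀ ⊗ ⋯ ⊗ [xᵢ, xⱼ] ⊗ ⋯ ⊗ x̂ⱼ ⊗ ⋯ ⊗ xₙ`: the entry at `j` is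
removed and the entry at `i` is replaced by the bracket. -/
noncomputable def boundaryTerm (n : ℕ) (j : Fin (n + 1)) (i : Fin n) :
    MultilinearMap F (fun _ : Fin (n + 1) => g) (CL F g n) :=
  MultilinearMap.mk'
    (fun x => PiTensorProduct.tprod F
      (Function.update (j.removeNth x) i (bracket (F := F) (x (j.succAbove i)) (x j))))
    (by
      intro x p a b
      rcases Fin.eq_self_or_eq_succAbove j p with rfl | ⟨q, rfl⟩
      · simp [Fin.removeNth_update]
      · by_cases hq : q = i
        · subst hq
          simp [Fin.removeNth_update_succAbove]
        · have h : j.succAbove i ≠ j.succAbove q := fun h =>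
            hq (Fin.succAbove_right_injective h).symm
          simp [Fin.removeNth_update_succAbove, h, Function.update_comm hq])
    (by
      intro x p c a
      rcases Fin.eq_self_or_eq_succAbove j p with rfl | ⟨q, rfl⟩
      · simp [Fin.removeNth_update]
      · by_cases hq : q = i
        · subst hq
          simp [Fin.removeNth_update_succAbove]
        · have h : j.succAbove i ≠ j.succAbove q := fun h =>
            hq (Fin.succAbove_right_injective h).symm
          simp [Fin.removeNth_update_succAbove, h, Function.update_comm hq])

/-- The boundary map `∂ₙ₊₁ : CLₙ₊₁(g) → CLₙ(g)`,
`x₁ ⊗ ⋯ ⊗ xₙ₊₁ ↦ ∑_{i < j} (-1)ʲ x₁ ⊗ ⋯ ⊗ [xᵢ, xⱼ] ⊗ ⋯ ⊗ x̂ⱼ ⊗ ⋯ ⊗ xₙ₊₁`.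
The sum is written with indices starting at `0`, hence the sign `(-1) ^ (j + 1)`. -/
noncomputable def boundary (n : ℕ) : CL F g (n + 1) →ₗ[F] CL F g n :=
  PiTensorProduct.lift
    (∑ j : Fin (n + 1), ∑ i : Fin n with i.castSucc < j,
      (-1 : F) ^ ((j : ℕ) + 1) • boundaryTerm F g n j i)

/-- The `n`-cycles, that is the kernel of `∂ₙ` (where `∂₀ = 0`). -/
noncomputable def cycles : (n : ℕ) → Submodule F (CL F g n)
  | 0 => ⊤
  | n + 1 => LinearMap.ker (boundary F g n)

/-- Leibniz homology with trivial coefficients, `HLₙ(g) = ker ∂ₙ / im ∂ₙ₊₁`. -/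
abbrev HL (n : ℕ) : Type _ :=
  cycles F g n ⧸ (LinearMap.range (boundary F g n)).submoduleOf (cycles F g n)

end Homology

end LeibnizAlgebra

/-! Write n = dim g and B = im ∂₃. The image of ∂₂ is g², so rank-nullity gives dim HL₂ + dim B +
dim g² = n² (`finrank_HL_two`), and it remains to bound the codimension of B in g ⊗ g. Modulo B one
has x ⊗ [y,z] ≡ [x,y] ⊗ z − [x,z] ⊗ y. This lets a tensor with one factor in g² be rewritten until
its other factor is a lift of a generator of g/Z(g); central factors contribute 0
(`pureTensor_derived_mem`). With K a complement of g² and S the span of d(g/Z(g)) lifts, g ⊗ g = B +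
K⊗K + g²⊗S + S⊗g². Counting dimensions gives the bound with an extra dim g² on the left, so equality
forces g² = 0. -/

namespace LeibnizAlgebra

variable {F : Type*} {g : Type*} [Field F] [AddCommGroup g] [Module F g]

/-! ### Degree-two chains and dimensions of tensor spaces -/

section Pure

variable (F g)

/-- The bilinear map `(x, y) ↦ x ⊗ y` into the chain space `CL₂(g)`. -/
noncomputable def pureTensor : g →ₗ[F] g →ₗ[F] CL F g 2 :=
  have h₀ (a x y : g) : Function.update ![a, y] 0 x = ![x, y] := by
    ext i; fin_cases i <;> rfl
  have h₁ (a x y : g) : Function.update ![x, a] 1 y = ![x, y] := by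
    ext i; fin_cases i <;> rfl
  LinearMap.mk₂ F (fun x y => PiTensorProduct.tprod F ![x, y])
    (fun a b y => by
      simpa only [h₀] using (PiTensorProduct.tprod F).map_update_add ![a, y] 0 a b)
    (fun c a y => by
      simpa only [h₀] using (PiTensorProduct.tprod F).map_update_smul ![a, y] 0 c a)
    (fun x a b => by
      simpa only [h₁] using (PiTensorProduct.tprod F).map_update_add ![x, a] 1 a b)
    (fun c x a => by
      simpa only [h₁] using (PiTensorProduct.tprod F).map_update_smul ![x, a] 1 c a)

end Pure

theorem pureTensor_apply (x y : g) :
    pureTensor F g x y = PiTensorProduct.tprod F ![x, y] := rfl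

variable (F g) in
theorem map₂_pureTensor_top : Submodule.map₂ (pureTensor F g) ⊤ ⊤ = ⊤ := by
  rw [eq_top_iff, ← PiTensorProduct.span_tprod_eq_top, Submodule.span_le]
  rintro _ ⟨x, rfl⟩
  have hx : x = ![x 0, x 1] := by ext i; fin_cases i <;> rfl
  rw [hx]
  exact Submodule.apply_mem_map₂ _ Submodule.mem_top Submodule.mem_top

theorem finrank_map₂_le {V W U : Type*} [AddCommGroup V] [Module F V] [AddCommGroup W] [Module F W]
    [AddCommGroup U] [Module F U] [FiniteDimensional F V] [FiniteDimensional F W]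
    (f : V →ₗ[F] W →ₗ[F] U) (P : Submodule F V) (Q : Submodule F W) :
    Module.finrank F (Submodule.map₂ f P Q) ≤ Module.finrank F P * Module.finrank F Q := by
  rw [← Module.finrank_tensorProduct]
  refine (Submodule.finrank_mono ?_).trans
    (LinearMap.finrank_range_le (TensorProduct.lift (f.domRestrict₁₂ P Q)))
  exact Submodule.map₂_le.2 fun x hx y hy => ⟨⟨x, hx⟩ ⊗ₜ ⟨y, hy⟩, rfl⟩

theorem finrank_CL [FiniteDimensional F g] (n : ℕ) :
    Module.finrank F (CL F g n) = Module.finrank F g ^ n := by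
  rw [Module.finrank_eq_card_basis
    (Basis.piTensorProduct fun _ : Fin n => Module.finBasis F g)]
  simp

variable [LeibnizAlgebra F g]

/-! ### Boundaries in low degree and the dimension of HL₂ -/

theorem boundary_one_tprod (x : Fin 2 → g) :
    boundary F g 1 (PiTensorProduct.tprod F x) =
      (PiTensorProduct.subsingletonEquiv 0).symm (bracket (F := F) (x 0) (x 1)) := by
  have h : Function.update (Fin.removeNth (α := fun _ : Fin 2 => g) 1 x) 0 (bracket (F := F) (x 0) (x 1)) =
      fun _ => bracket (F := F) (x 0) (x 1) := by
    ext i; fin_cases i; rfl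
  rw [boundary, PiTensorProduct.lift.tprod, PiTensorProduct.subsingletonEquiv_symm_apply', ← h]
  simp [boundaryTerm, Fin.sum_univ_succ, Finset.sum_filter]

theorem boundary_two_tprod (x y z : g) :
    boundary F g 2 (PiTensorProduct.tprod F ![x, y, z]) =
      pureTensor F g (bracket (F := F) x y) z - pureTensor F g (bracket (F := F) x z) y -
        pureTensor F g x (bracket (F := F) y z) := by
  have h₁ : Function.update (Fin.removeNth (α := fun _ : Fin 3 => g) 1 ![x, y, z]) 0 (bracket (F := F) x y) =
      ![bracket (F := F) x y, z] := by
    ext i; fin_cases i <;> rfl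
  have h₂ : Function.update (Fin.removeNth (α := fun _ : Fin 3 => g) 2 ![x, y, z]) 0 (bracket (F := F) x z) =
      ![bracket (F := F) x z, y] := by
    ext i; fin_cases i <;> rfl
  have h₃ : Function.update (Fin.removeNth (α := fun _ : Fin 3 => g) 2 ![x, y, z]) 1 (bracket (F := F) y z) =
      ![x, bracket (F := F) y z] := by
    ext i; fin_cases i <;> rfl
  rw [boundary, PiTensorProduct.lift.tprod, pureTensor_apply, pureTensor_apply, pureTensor_apply,
    ← h₁, ← h₂, ← h₃]
  simp [boundaryTerm, Fin.sum_univ_succ, Finset.sum_filter]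
  module

theorem boundary_one_pureTensor (x y : g) :
    boundary F g 1 (pureTensor F g x y) =
      (PiTensorProduct.subsingletonEquiv 0).symm (bracket (F := F) x y) :=
  boundary_one_tprod _

variable (F g)

/-- On pure tensors, ∂₂ ∘ ∂₃ = 0 is exactly the Leibniz identity. -/
theorem range_boundary_two_le_cycles : LinearMap.range (boundary F g 2) ≤ cycles F g 2 := by
  rw [LinearMap.range_eq_map, ← PiTensorProduct.span_tprod_eq_top, Submodule.map_span,
    Submodule.span_le]
  rintro _ ⟨_, ⟨x, rfl⟩, rfl⟩
  have hx : x = ![x 0, x 1, x 2] := by ext i; fin_cases i <;> rfl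
  rw [hx, boundary_two_tprod]
  change boundary F g 1 _ = 0
  simp only [map_sub, boundary_one_pureTensor, leibniz (F := F) (x 0) (x 1) (x 2)]
  abel

theorem finrank_range_boundary_one :
    Module.finrank F (LinearMap.range (boundary F g 1)) = Module.finrank F (derived F g) := by
  have h : LinearMap.range (boundary F g 1) = (derived F g).map
      ((PiTensorProduct.subsingletonEquiv (R := F) (s := fun _ : Fin 1 => g) 0).symm :
        g →ₗ[F] CL F g 1) := by
    rw [LinearMap.range_eq_map, ← map₂_pureTensor_top, derived, commutator, Submodule.map_map₂,
      Submodule.map_map₂]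
    congr 1
    ext x y
    exact boundary_one_pureTensor x y
  rw [h]
  exact LinearEquiv.finrank_map_eq _ _

/-- Rank-nullity for ∂₂, whose image is a copy of g², combined with the dimension of the quotient of
its kernel by im ∂₃. -/
theorem finrank_HL_two [FiniteDimensional F g] :
    Module.finrank F (HL F g 2) + Module.finrank F (LinearMap.range (boundary F g 2)) +
      Module.finrank F (derived F g) = Module.finrank F g ^ 2 := by
  have h₁ := LinearMap.finrank_range_add_finrank_ker (boundary F g 1)
  have h₂ := Submodule.finrank_quotient_add_finrank
    ((LinearMap.range (boundary F g 2)).submoduleOf (cycles F g 2))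
  rw [(Submodule.submoduleOfEquivOfLe (range_boundary_two_le_cycles F g)).finrank_eq] at h₂
  rw [finrank_range_boundary_one, finrank_CL] at h₁
  change _ + Module.finrank F (cycles F g 2) = Module.finrank F g ^ 2 at h₁
  change Module.finrank F (HL F g 2) + _ = _ at h₂
  omega

/-! ### Generators of g/Z(g) and reduction modulo boundaries -/

theorem exists_finset_generatedBy [FiniteDimensional F g] :
    ∃ s : Finset g, s.card = minGenerators F g ∧ generatedBy F g (s : Set g) = ⊤ := by
  -- The infimum is attained only if the set is nonempty (otherwise it is the default 0); a finite
  -- spanning set is a witness.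
  refine Nat.sInf_mem (s := {n | ∃ s : Finset g, s.card = n ∧ generatedBy F g (s : Set g) = ⊤}) ?_
  obtain ⟨s, hs⟩ := Module.Finite.fg_top (R := F) (M := g)
  refine ⟨_, s, rfl, ?_⟩
  rw [eq_top_iff, ← hs, generatedBy]
  exact le_sInf fun U hU => Submodule.span_le.2 hU.1

variable {F g}

/-- The image of T in g/I is a subalgebra containing the generators, hence everything; as T contains
I, it is the full preimage of its image. This is the induction principle behind the reduction to
generators. -/
theorem eq_top_of_generatedBy_quotient (I : LeibnizIdeal F g) (s : Set (g ⧸ I.toSubmodule))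
    (hs : generatedBy F _ s = ⊤) (t : Set g) (hts : s ⊆ I.toSubmodule.mkQ '' t)
    (T : Submodule F g) (hI : I.toSubmodule ≤ T) (htT : t ⊆ T)
    (hT : ∀ x ∈ T, ∀ y ∈ T, bracket (F := F) x y ∈ T) : T = ⊤ := by
  have h : generatedBy F _ s ≤ T.map I.toSubmodule.mkQ := by
    refine sInf_le ⟨hts.trans (Set.image_mono htT), ?_⟩
    rintro _ ⟨x, hx, rfl⟩ _ ⟨y, hy, rfl⟩
    exact ⟨_, hT x hx y hy, rfl⟩
  rw [hs, top_le_iff] at h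
  have := Submodule.comap_map_mkQ I.toSubmodule T
  rwa [h, Submodule.comap_top, sup_eq_right.2 hI, eq_comm] at this

theorem pureTensor_bracket_right (x y z : g) :
    pureTensor F g x (bracket (F := F) y z) =
      pureTensor F g (bracket (F := F) x y) z - pureTensor F g (bracket (F := F) x z) y -
        boundary F g 2 (PiTensorProduct.tprod F ![x, y, z]) := by
  rw [boundary_two_tprod]; abel

theorem bracket_mem_derived (x y : g) : bracket (F := F) x y ∈ derived F g :=
  Submodule.apply_mem_map₂ _ Submodule.mem_top Submodule.mem_top

/-- Tensors with a factor in `g²` reduce, modulo boundaries, to those whose other factor is one of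
the lifts of generators of `g ⧸ Z(g)`. -/
theorem pureTensor_derived_mem (s : Set (g ⧸ (center F g).toSubmodule))
    (hs : generatedBy F _ s = ⊤) (t : Set g) (hts : s ⊆ (center F g).toSubmodule.mkQ '' t)
    (N : Submodule F (CL F g 2)) (hB : LinearMap.range (boundary F g 2) ≤ N)
    (hl : ∀ w ∈ derived F g, ∀ x ∈ t, pureTensor F g w x ∈ N)
    (hr : ∀ w ∈ derived F g, ∀ x ∈ t, pureTensor F g x w ∈ N)
    (w : g) (hw : w ∈ derived F g) (x : g) :
    pureTensor F g w x ∈ N ∧ pureTensor F g x w ∈ N := by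
  have hb (u) : boundary F g 2 u ∈ N := hB ⟨u, rfl⟩
  have hL : ∀ x w, w ∈ derived F g → pureTensor F g w x ∈ N := by
    -- T = {x : g² ⊗ x ⊆ N} is shown to be a subalgebra containing Z(g) and t. For central z, [x,y]
    -- ⊗ z is itself a boundary.
    let T : Submodule F g := ⨅ w ∈ derived F g, N.comap (pureTensor F g w)
    have memT {x} : x ∈ T ↔ ∀ w ∈ derived F g, pureTensor F g w x ∈ N := by
      simp [T, Submodule.mem_iInf]
    suffices T = ⊤ from fun x => memT.1 (this ▸ Submodule.mem_top)
    refine eq_top_of_generatedBy_quotient (center F g) s hs t hts T ?_ ?_ ?_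
    · intro z hz
      suffices derived F g ≤ N.comap ((pureTensor F g).flip z) from memT.2 this
      refine Submodule.map₂_le.2 fun x _ y _ => ?_
      have h := pureTensor_bracket_right (F := F) x y z
      rw [(hz x).2, (hz y).2] at h
      have := hb (PiTensorProduct.tprod F ![x, y, z])
      simp only [map_zero, LinearMap.zero_apply, sub_zero] at h
      change pureTensor F g (bracket (F := F) x y) z ∈ N
      rwa [sub_eq_zero.1 h.symm]
    · exact fun x hx => memT.2 fun w hw => hl w hw x hx
    · exact fun x hx y hy => memT.2 fun w _ => by
        rw [pureTensor_bracket_right]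
        exact N.sub_mem (N.sub_mem (memT.1 hy _ (bracket_mem_derived _ _))
          (memT.1 hx _ (bracket_mem_derived _ _))) (hb _)
  refine ⟨hL x w hw, ?_⟩
  -- The mirror image, T = {x : x ⊗ g² ⊆ N}. Closure under the bracket needs the half just proved,
  -- since [x,y] ⊗ w ≡ x ⊗ [y,w] + [x,w] ⊗ y.
  let T : Submodule F g := ⨅ w ∈ derived F g, N.comap ((pureTensor F g).flip w)
  have memT {x} : x ∈ T ↔ ∀ w ∈ derived F g, pureTensor F g x w ∈ N := by
    simp [T, Submodule.mem_iInf]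
  suffices T = ⊤ from memT.1 (this ▸ Submodule.mem_top) w hw
  refine eq_top_of_generatedBy_quotient (center F g) s hs t hts T ?_ ?_ ?_
  · intro z hz
    suffices derived F g ≤ N.comap (pureTensor F g z) from memT.2 this
    refine Submodule.map₂_le.2 fun x _ y _ => ?_
    change pureTensor F g z (bracket (F := F) x y) ∈ N
    rw [pureTensor_bracket_right, (hz x).1, (hz y).1]
    simpa using hb _
  · exact fun x hx => memT.2 fun w hw => hr w hw x hx
  · intro x hx y hy
    refine memT.2 fun w hw => ?_
    have h : pureTensor F g (bracket (F := F) x y) w =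
        pureTensor F g x (bracket (F := F) y w) + pureTensor F g (bracket (F := F) x w) y +
          boundary F g 2 (PiTensorProduct.tprod F ![x, y, w]) := by
      rw [boundary_two_tprod]; abel
    rw [h]
    exact N.add_mem (N.add_mem (memT.1 hx _ (bracket_mem_derived _ _))
      (hL _ _ (bracket_mem_derived _ _))) (hb _)

/-! ### The sharpened bound and the case of equality -/

theorem finrank_HL_two_add_finrank_derived_le [FiniteDimensional F g] :
    Module.finrank F (HL F g 2) + Module.finrank F (derived F g) ≤
      (Module.finrank F g - Module.finrank F (derived F g)) ^ 2 +
        2 * Module.finrank F (derived F g) *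
          minGenerators F (g ⧸ (center F g).toSubmodule) := by
  classical
  obtain ⟨s, hcard, hs⟩ := exists_finset_generatedBy F (g ⧸ (center F g).toSubmodule)
  obtain ⟨K, hK⟩ := (derived F g).exists_isCompl
  have hKrank := Submodule.finrank_add_eq_of_isCompl hK
  let t : Finset g := s.image Quotient.out
  have hts : (s : Set (g ⧸ (center F g).toSubmodule)) ⊆ (center F g).toSubmodule.mkQ '' t := by
    intro x hx
    exact ⟨x.out, Finset.mem_coe.2 (Finset.mem_image_of_mem _ hx), Quotient.out_eq x⟩
  set S : Submodule F g := Submodule.span F (t : Set g)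
  have hS : Module.finrank F S ≤ minGenerators F (g ⧸ (center F g).toSubmodule) :=
    (finrank_span_finset_le_card t).trans (Finset.card_image_le.trans hcard.le)
  set B := LinearMap.range (boundary F g 2)
  set W₀ := Submodule.map₂ (pureTensor F g) K K
  set W₁ := Submodule.map₂ (pureTensor F g) (derived F g) S
  set W₂ := Submodule.map₂ (pureTensor F g) S (derived F g)
  have hN := pureTensor_derived_mem (s : Set _) hs (t : Set g) hts (B ⊔ W₀ ⊔ W₁ ⊔ W₂)
    (le_sup_left.trans (le_sup_left.trans le_sup_left))
    (fun w hw x hx => (le_sup_right.trans le_sup_left : W₁ ≤ _)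
      (Submodule.apply_mem_map₂ _ hw (Submodule.subset_span hx)))
    (fun w hw x hx => (le_sup_right : W₂ ≤ _)
      (Submodule.apply_mem_map₂ _ (Submodule.subset_span hx) hw))
  have htop : B ⊔ W₀ ⊔ W₁ ⊔ W₂ = ⊤ := by
    rw [eq_top_iff, ← map₂_pureTensor_top]
    refine Submodule.map₂_le.2 fun x _ y _ => ?_
    obtain ⟨a, ha, b, hb, rfl⟩ := Submodule.mem_sup.1
      (hK.sup_eq_top ▸ Submodule.mem_top : x ∈ derived F g ⊔ K)
    obtain ⟨c, hc, d, hd, rfl⟩ := Submodule.mem_sup.1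
      (hK.sup_eq_top ▸ Submodule.mem_top : y ∈ derived F g ⊔ K)
    -- Split (a+b) ⊗ (c+d) as a ⊗ (c+d) + b ⊗ c + b ⊗ d: the first two terms have a factor in g²,
    -- the last lies in K ⊗ K.
    rw [map_add (pureTensor F g), LinearMap.add_apply, map_add (pureTensor F g b)]
    refine add_mem (hN a ha _).1 (add_mem (hN c hc b).2 ?_)
    exact (le_sup_right.trans (le_sup_left.trans le_sup_left) : W₀ ≤ _)
      (Submodule.apply_mem_map₂ _ hb hd)
  have h₀ := finrank_map₂_le (pureTensor F g) K K
  have h₁ := (finrank_map₂_le (pureTensor F g) (derived F g) S).trans (Nat.mul_le_mul_left _ hS)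
  have h₂ := (finrank_map₂_le (pureTensor F g) S (derived F g)).trans (Nat.mul_le_mul_right _ hS)
  have e₀ := Submodule.finrank_add_le_finrank_add_finrank B W₀
  have e₁ := Submodule.finrank_add_le_finrank_add_finrank (B ⊔ W₀) W₁
  have e₂ := Submodule.finrank_add_le_finrank_add_finrank (B ⊔ W₀ ⊔ W₁) W₂
  -- Expanding n² through HL₂ puts dim B on both sides of the estimate, where it cancels.
  rw [htop, finrank_top, finrank_CL, ← finrank_HL_two] at e₂
  have hk : Module.finrank F g - Module.finrank F (derived F g) = Module.finrank F K := by omega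
  rw [hk]
  nlinarith

theorem derived_eq_bot_iff : derived F g = ⊥ ↔ IsAbelian F g := by
  rw [← le_bot_iff, derived, commutator, Submodule.map₂_le]
  simp [IsAbelian]

end LeibnizAlgebra

theorem corollary3p8 {F : Type*} {g : Type*} [Field F] [AddCommGroup g] [Module F g]
    [LeibnizAlgebra F g] [FiniteDimensional F g] (hg : LeibnizAlgebra.IsNilpotent F g) :
    (Module.finrank F (LeibnizAlgebra.HL F g 2) : ℤ) ≤
        ((Module.finrank F g : ℤ) - Module.finrank F (LeibnizAlgebra.derived F g)) ^ 2 +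
          2 * Module.finrank F (LeibnizAlgebra.derived F g) *
            LeibnizAlgebra.minGenerators F (g ⧸ (LeibnizAlgebra.center F g).toSubmodule) ∧
      ((Module.finrank F (LeibnizAlgebra.HL F g 2) : ℤ) =
          ((Module.finrank F g : ℤ) - Module.finrank F (LeibnizAlgebra.derived F g)) ^ 2 +
            2 * Module.finrank F (LeibnizAlgebra.derived F g) *
              LeibnizAlgebra.minGenerators F (g ⧸ (LeibnizAlgebra.center F g).toSubmodule) ↔
        LeibnizAlgebra.IsAbelian F g) := by
  have hle := LeibnizAlgebra.finrank_HL_two_add_finrank_derived_le (F := F) (g := g)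
  zify [Submodule.finrank_le (LeibnizAlgebra.derived F g)] at hle
  refine ⟨by linarith, fun h => ?_, fun h => ?_⟩
  -- Equality leaves no room for the extra dim g² in `hle`.
  · rw [← LeibnizAlgebra.derived_eq_bot_iff, ← Submodule.finrank_eq_zero (R := F)]
    zify
    exact le_antisymm (by linarith) (Int.natCast_nonneg _)
  -- With zero bracket both ∂₃ and g² vanish, so dim HL₂ = n².
  · have hbot := LeibnizAlgebra.derived_eq_bot_iff.2 h
    have hdim := LeibnizAlgebra.finrank_HL_two F g
    have hB : LinearMap.range (LeibnizAlgebra.boundary F g 2) = ⊥ := by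
      rw [LinearMap.range_eq_bot]
      ext x
      have hx : x = ![x 0, x 1, x 2] := by ext i; fin_cases i <;> rfl
      rw [LinearMap.compMultilinearMap_apply, hx, LeibnizAlgebra.boundary_two_tprod]
      simp [h _ _]
    have hr := (congrArg (fun U : Submodule F _ => Module.finrank F U) hB).trans (finrank_bot F _)
    have hd := (congrArg (fun U : Submodule F _ => Module.finrank F U) hbot).trans (finrank_bot F _)
    rw [hr, hd] at hdim
    rw [hd]
    zify at hdim
    simpa using hdim
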